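/- A partition is a weakly decreasing finite sequence $\lambda=(\lambda_1\ge\lambda_2\ge\dots\ge\lambda_r>0)$ of positive integers (possibly empty, and extended by trailing zeros), and $\lambda^*$ denotes its conjugate. For partitions $\lambda,\mu$, not necessarily of the same size, $\mu$ dominates $\lambda$ if $\sum_{i=1}^k\lambda_i\le\sum_{i=1}^k\mu_i$ for all $k\ge1$, and $\mu$ doubly dominates $\lambda$ if $\mu$ dominates $\lambda$ and $\mu^*$ dominates $\lambda^*$. A hook is a partition $(n,1^m)$ with $n\ge 1$, $m\ge 0$. The shape of a permutation is the shape of its tableaux under the Robinson–Schensted–Knuth correspondence. A permutation class is a set of permutations (of all finite lengths) closed under taking subpermutations (patterns); $\mathrm{Av}(\sigma)$ is the class of permutations that do not contain the pattern $\sigma$. A Young class is a permutation class that, for each partition $\lambda$, contains either all permutations of shape $\lambda$ or none of them; it is proper if it is not the class of all permutations. Then: 1. Every partition is doubly dominated by some hook $(n,1^m)$. 2. For every proper Young class $\mathcal C$ there is a constant $k$ such that no permutation in $\mathcal C$ has both an increasing and a decreasing subsequence of length $k$. 3. For every proper Young class $\mathcal C$ there are $a,d$ such that $\mathcal C\subseteq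 \mathrm{Av}(12\cdots a)\cup\mathrm{Av}(d\cdots 21)$. Moreover, for every permutation class $\mathcal C$, the existence of $k$ as in 2 is equivalent to the existence of $a,d$ as in 3. -/

import Mathlib

namespace YoungClasses

/-! ### Partitions

Partitions are represented by Young diagrams (English convention): `μ.rowLen i` is the `(i+1)`-st
part (`0` past the last one), `μ.transpose` is the conjugate partition. -/

/-- `Dominates μ lam`: every partial sum of parts of `lam` is at most that of `μ`
(the sizes of `lam` and `μ` need not agree). -/
def Dominates (μ lam : YoungDiagram) : Prop :=
  ∀ k : ℕ, ∑ i ∈ Finset.range k, lam.rowLen i ≤ ∑ i ∈ Finset.range k, μ.rowLen i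

/-- `μ` doubly dominates `lam`: `μ` dominates `lam`, and so it is for the conjugates. -/
def DoublyDominates (μ lam : YoungDiagram) : Prop :=
  Dominates μ lam ∧ Dominates μ.transpose lam.transpose

/-- `μ` is the hook `(n, 1^m)`: a first part `n ≥ 1`, then `m` parts equal to `1`. -/
def IsHook (μ : YoungDiagram) (n m : ℕ) : Prop :=
  1 ≤ n ∧ μ.rowLens = n :: List.replicate m 1

/-! ### Robinson–Schensted insertion -/

/-- Row insertion of `x`: the leftmost entry larger than `x` is replaced by `x` and bumped out
(second component); if there is none, `x` is appended. -/
def rowInsert (x : ℕ) : List ℕ → List ℕ × Option ℕ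
  | [] => ([x], none)
  | y :: ys => if x < y then (x :: ys, some y) else (y :: (rowInsert x ys).1, (rowInsert x ys).2)

/-- Insertion of `x` into a tableau, given as the list of its rows from top to bottom: `x` is
inserted into the first row, and a bumped entry is inserted into the tableau of the rows below. -/
def tableauInsert : List (List ℕ) → ℕ → List (List ℕ)
  | [], x => [[x]]
  | r :: rs, x =>
    match rowInsert x r with
    | (r', none) => r' :: rs
    | (r', some y) => r' :: tableauInsert rs y

/-- The insertion tableau of a word. -/
def insertionTableau (w : List ℕ) : List (List ℕ) :=
  w.foldl tableauInsert []

/-- Row `r` may stand directly above row `s` in a tableau: `s` is not longer than `r`, and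
the entries increase strictly from `r` to `s` in each column. -/
def Above : List ℕ → List ℕ → Prop
  | _, [] => True
  | [], _ :: _ => False
  | a :: r, b :: s => a < b ∧ Above r s

theorem Above.length_le : ∀ {r s : List ℕ}, Above r s → s.length ≤ r.length
  | _, [], _ => by simp
  | [], _ :: _, h => h.elim
  | _ :: _, _ :: _, h => by simpa using Above.length_le h.2

theorem lt_of_rowInsert {x y : ℕ} : ∀ {r : List ℕ}, (rowInsert x r).2 = some y → x < y
  | [], h => by simp [rowInsert] at h
  | a :: r, h => by
    by_cases hx : x < a
    · simp [rowInsert, hx] at h; omega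
    · simp only [rowInsert, hx, if_false] at h; exact lt_of_rowInsert h

theorem above_rowInsert (x : ℕ) : ∀ {r s : List ℕ}, Above r s → Above (rowInsert x r).1 s
  | _, [], _ => by simp [Above]
  | [], _ :: _, h => h.elim
  | a :: r, b :: s, h => by
    by_cases hx : x < a
    · simp only [rowInsert, hx, if_true]; exact ⟨hx.trans h.1, h.2⟩
    · simp only [rowInsert, hx, if_false]; exact ⟨h.1, above_rowInsert x h.2⟩

theorem above_rowInsert_rowInsert {x y : ℕ} : ∀ {r s : List ℕ}, Above r s →
    (rowInsert x r).2 = some y → Above (rowInsert x r).1 (rowInsert y s).1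
  | [], _, _, h => by simp [rowInsert] at h
  | a :: r, s, hs, h => by
    have hxy := lt_of_rowInsert h
    by_cases hx : x < a
    · have hy : a = y := by simpa [rowInsert, hx] using h
      subst hy
      cases s with
      | nil => simp [rowInsert, hx, Above]
      | cons b s => simp only [rowInsert, hx, hs.1, if_true]; exact ⟨hx, hs.2⟩
    · have h' : (rowInsert x r).2 = some y := by simpa [rowInsert, hx] using h
      cases s with
      | nil => simp only [rowInsert, hx, if_false]; exact ⟨by omega, by simp [Above]⟩
      | cons b s =>
        by_cases hb : y < b
        · simp only [rowInsert, hx, hb, if_false, if_true]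
          exact ⟨by omega, above_rowInsert x hs.2⟩
        · simp only [rowInsert, hx, hb, if_false]
          exact ⟨hs.1, above_rowInsert_rowInsert hs.2 h'⟩

theorem isChain_tableauInsert : ∀ (T : List (List ℕ)) (x : ℕ), T.IsChain Above →
    (tableauInsert T x).IsChain Above
  | [], x, _ => by simp [tableauInsert]
  | [r], x, _ => by
    rcases h : rowInsert x r with ⟨r', _ | y⟩
    · simp [tableauInsert, h]
    · have := above_rowInsert_rowInsert (x := x) (y := y) (r := r) (s := [])
        (by cases r <;> trivial) (by simp [h])
      simpa [tableauInsert, h, rowInsert] using this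
  | r :: s :: T, x, hT => by
    have hrs : Above r s := by simp at hT; exact hT.1
    have hsT : (s :: T).IsChain Above := by simp at hT; exact hT.2
    rcases h : rowInsert x r with ⟨r', _ | y⟩
    · have h1 := above_rowInsert x hrs
      rw [h] at h1
      simp only [tableauInsert, h, List.isChain_cons_cons]
      exact ⟨h1, hsT⟩
    · have h1 := above_rowInsert_rowInsert hrs (x := x) (y := y) (by simp [h])
      rw [h] at h1
      have ih := isChain_tableauInsert (s :: T) y hsT
      rcases h2 : rowInsert y s with ⟨s', _ | z⟩ <;>
        simp only [tableauInsert, h, h2, List.isChain_cons_cons] at h1 ih ⊢ <;> exact ⟨h1, ih⟩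

theorem isChain_insertionTableau (w : List ℕ) : (insertionTableau w).IsChain Above := by
  have : ∀ (w : List ℕ) (T : List (List ℕ)), T.IsChain Above →
      (w.foldl tableauInsert T).IsChain Above := by
    intro w
    induction w with
    | nil => intro T h; exact h
    | cons x w ih => intro T h; exact ih _ (isChain_tableauInsert T x h)
  exact this w [] (by simp)

theorem sortedGE_insertionTableau (w : List ℕ) :
    ((insertionTableau w).map List.length).SortedGE := by
  rw [List.sortedGE_iff_isChain, List.isChain_map]
  exact (isChain_insertionTableau w).imp fun _ _ h => h.length_le

/-! ### Permutations -/

/-- Permutations of all finite lengths (the values are `0, …, n - 1`). -/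
abbrev Permutation : Type := Σ n : ℕ, Equiv.Perm (Fin n)

/-- The word `π(0) π(1) … π(n-1)` of a permutation. -/
def word (π : Permutation) : List ℕ :=
  List.ofFn fun i => (π.2 i : ℕ)

/-- The shape of `π`: the partition formed by the row lengths of its insertion tableau. -/
def shape (π : Permutation) : YoungDiagram :=
  YoungDiagram.ofRowLens ((insertionTableau (word π)).map List.length)
    (sortedGE_insertionTableau (word π))

/-- `σ` is involved in `π`: some subsequence of `π` is in the same relative order as `σ`. -/
def Involved (σ π : Permutation) : Prop :=
  ∃ f : Fin σ.1 ↪o Fin π.1, ∀ i j, σ.2 i < σ.2 j ↔ π.2 (f i) < π.2 (f j)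

/-- A permutation class: a set of permutations closed downwards under involvement. -/
def IsPermClass (C : Set Permutation) : Prop :=
  ∀ σ π : Permutation, Involved σ π → π ∈ C → σ ∈ C

/-- The permutations avoiding all elements of `X`. -/
def Av (X : Set Permutation) : Set Permutation :=
  {π | ∀ σ ∈ X, ¬ Involved σ π}

/-- The increasing permutation `1 2 … a`. -/
def increasing (a : ℕ) : Permutation := ⟨a, Equiv.refl (Fin a)⟩

/-- The decreasing permutation `d … 2 1`. -/
def decreasing (d : ℕ) : Permutation := ⟨d, Fin.revPerm⟩

/-- `π` has an increasing subsequence of length `k`. -/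
def HasIncreasing (π : Permutation) (k : ℕ) : Prop :=
  ∃ f : Fin k ↪o Fin π.1, StrictMono fun i => π.2 (f i)

/-- `π` has a decreasing subsequence of length `k`. -/
def HasDecreasing (π : Permutation) (k : ℕ) : Prop :=
  ∃ f : Fin k ↪o Fin π.1, StrictAnti fun i => π.2 (f i)

/-- A Young class: a permutation class that contains, for each partition, all permutations of that
shape or none of them. -/
def IsYoungClass (C : Set Permutation) : Prop :=
  IsPermClass C ∧
    ∀ lam : YoungDiagram, (∀ π, shape π = lam → π ∈ C) ∨ (∀ π, shape π = lam → π ∉ C)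

end YoungClasses

/-!
A hook with a long first row and a long first column doubly dominates a given partition, because
all partial sums of a partition are bounded by its size.

The equivalence of the two bounds on monotone subsequences is formal: `π` avoids `increasing a`
exactly if it has no increasing subsequence of length `a`, and `a` and `d` may be replaced by their
maximum.

It remains to bound the monotone subsequences in a proper Young class `C`. There are two steps.

* `C` omits all permutations of some hook shape (`IsYoungClass.exists_omits_hook`). Some permutation
  is not in `C`, so `C` omits its shape. If some permutation of shape `μ` involves one of shape
  `λ`, and `C` omits `λ`, then `C` omits `μ`. This applies if `μ` arises from `λ` by deleting the
  lowest corner `(i, j)` with `i, j ≥ 2` and adding one box to the first row and one to the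
  first column (`exists_sublist_rowLengths`). For this, fill the rows of `λ` of length at least
  two column by column, and the rows of length one with values that continue column `j`; the
  reading word (rows from bottom to top) has this filling as its insertion tableau. Insert into the word, after the
  row `i` of the corner, a letter `x` whose value lies between columns `j - 1` and `j`. It bumps the
  corner entry to a new row below. Every row read later takes `x` out of the row beneath it and
  up into the top row, and otherwise only pushes the tableau down (`foldl_tableauInsert_split`), so
  that the final top row has gained a box. Repeating the move ends at a hook.

* A permutation with sufficiently long increasing and decreasing subsequences involves a
  permutation of the given hook shape (`exists_sublist_rowLengths_eq_hook`): up to the order of the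
  two parts, it involves a decreasing sequence followed by an increasing one, and
  the insertion tableau of such a word is a hook.

All this is done with words of distinct numbers. Row insertion commutes with strictly increasing
relabellings, so these may stand for permutations (`exists_word_map_eq`, `rowLengths_map`).
-/

namespace YoungClasses

open scoped List

/-! ### Insertion of words -/

/-- Row insertion of a word, letter by letter, into a row: the resulting row, and the word of the
bumped letters. -/
def rowInsertWord : List ℕ → List ℕ → List ℕ × List ℕ
  | r, [] => (r, [])
  | r, x :: w =>
    ((rowInsertWord (rowInsert x r).1 w).1,
      (rowInsert x r).2.toList ++ (rowInsertWord (rowInsert x r).1 w).2)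

theorem foldl_tableauInsert_cons (r : List ℕ) (T : List (List ℕ)) (w : List ℕ) :
    w.foldl tableauInsert (r :: T) =
      (rowInsertWord r w).1 :: (rowInsertWord r w).2.foldl tableauInsert T := by
  induction w generalizing r T with
  | nil => rfl
  | cons x w ih =>
    rcases h : rowInsert x r with ⟨r', _ | y⟩ <;>
      simp [rowInsertWord, tableauInsert, h, ih]

theorem foldl_tableauInsert_nil {w : List ℕ} (hw : w ≠ []) :
    w.foldl tableauInsert [] = w.foldl tableauInsert [[]] := by
  cases w with
  | nil => exact absurd rfl hw
  | cons x w => simp [tableauInsert, rowInsert]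

theorem rowInsert_append {x : ℕ} {p : List ℕ} (hp : ∀ y ∈ p, y ≤ x) (r : List ℕ) :
    rowInsert x (p ++ r) = (p ++ (rowInsert x r).1, (rowInsert x r).2) := by
  induction p with
  | nil => rfl
  | cons y p ih =>
    have h1 : ¬ x < y := by have := hp y (by simp); omega
    simp [rowInsert, h1, ih fun z hz => hp z (by simp [hz])]

theorem rowInsertWord_append (r u v : List ℕ) :
    rowInsertWord r (u ++ v) =
      ((rowInsertWord (rowInsertWord r u).1 v).1,
        (rowInsertWord r u).2 ++ (rowInsertWord (rowInsertWord r u).1 v).2) := by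
  induction u generalizing r with
  | nil => rfl
  | cons x u ih => simp [rowInsertWord, ih]

/-- An increasing word that may stand above the end `b` of a row replaces `b`, and bumps it
letter by letter. -/
theorem rowInsertWord_of_above {p r b : List ℕ} (h : (p ++ r).SortedLT) (hb : Above r b) :
    rowInsertWord (p ++ b) r = (p ++ r, b) := by
  induction r generalizing p b with
  | nil => cases b with
    | nil => rfl
    | cons _ _ => exact hb.elim
  | cons x r ih =>
    have hp : ∀ y ∈ p, y ≤ x := by
      intro y hy
      have := (List.pairwise_append.1 h.pairwise).2.2 y hy x (by simp)
      exact this.le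
    have h' : ((p ++ [x]) ++ r).SortedLT := by simpa using h
    cases b with
    | nil =>
      have := ih (p := p ++ [x]) (b := []) h' (by cases r <;> trivial)
      simp only [List.append_nil] at this
      have h2 : rowInsert x p = (p ++ [x], none) := by
        simpa [rowInsert] using rowInsert_append hp []
      simp [rowInsertWord, h2, this]
    | cons y b =>
      have := ih (p := p ++ [x]) (b := b) h' hb.2
      simp only [List.append_assoc, List.singleton_append] at this
      simp [rowInsertWord, rowInsert_append hp, rowInsert, hb.1, this]

/-- Inserting a row that may stand on top of a tableau pushes the whole tableau down. -/
theorem foldl_tableauInsert_of_above {r : List ℕ} {T : List (List ℕ)}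
    (hc : (r :: T).IsChain Above) (hs : ∀ s ∈ r :: T, s.SortedLT) (hn : ∀ s ∈ r :: T, s ≠ []) :
    r.foldl tableauInsert T = r :: T := by
  induction T generalizing r with
  | nil =>
    rw [foldl_tableauInsert_nil (hn r (by simp)), foldl_tableauInsert_cons]
    have := rowInsertWord_of_above (p := []) (b := []) (r := r) (hs r (by simp))
      (by cases r <;> trivial)
    simp only [List.nil_append] at this
    simp [this]
  | cons b T ih =>
    rw [List.isChain_cons_cons] at hc
    have := rowInsertWord_of_above (p := []) (b := b) (r := r) (hs r (by simp)) hc.1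
    simp only [List.nil_append] at this
    rw [foldl_tableauInsert_cons, this]
    simp only
    rw [ih hc.2 (fun s h => hs s (by simp [h])) (fun s h => hn s (by simp [h]))]

/-- Suppose that a letter `x` sits between the parts `p` and `q` of the top row, where the letters
of the next row to be read split as `p'` below `x` and `q'` above `x`. Then reading that row moves
`x` to the new top row and leaves the old top row behind without `x`. -/
theorem foldl_tableauInsert_split {p q p' q' : List ℕ} {x : ℕ} {T : List (List ℕ)}
    (hp : Above p' p) (hl : p'.length = p.length) (hq : Above q' q)
    (hx : (p' ++ x :: q').SortedLT)
    (hc : ((p ++ q) :: T).IsChain Above) (hs : ∀ s ∈ (p ++ q) :: T, s.SortedLT)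
    (hn : ∀ s ∈ (p ++ q) :: T, s ≠ []) :
    (p' ++ q').foldl tableauInsert ((p ++ x :: q) :: T) =
      (p' ++ x :: q') :: (p ++ q) :: T := by
  have key : ∀ {p' p : List ℕ} (u : List ℕ), (u ++ p').SortedLT → Above p' p →
      p'.length = p.length → ∀ t : List ℕ,
      rowInsertWord (u ++ (p ++ t)) p' = (u ++ (p' ++ t), p) := by
    intro p'
    induction p' with
    | nil =>
      intro p u _ _ hl t
      have : p = [] := by simpa using hl.symm
      subst this; rfl
    | cons a p' ih =>
      intro p u hu hab hl t
      cases p with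
      | nil => simp at hl
      | cons b p =>
        have hu' : ∀ y ∈ u, y ≤ a := fun y hy =>
          ((List.pairwise_append.1 hu.pairwise).2.2 y hy a (by simp)).le
        have := ih (p := p) (u ++ [a]) (by simpa using hu) hab.2 (by simpa using hl) t
        simp only [List.append_assoc, List.singleton_append] at this
        simp [rowInsertWord, rowInsert_append hu', rowInsert, hab.1, this]
  have h1 := key (p' := p') (p := p) [] (by
    have := hx.pairwise
    exact ((List.pairwise_append.1 this).1).sortedLT) hp hl (x :: q)
  have h2 := rowInsertWord_of_above (p := p' ++ [x]) (r := q') (b := q) (by simpa using hx) hq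
  simp only [List.nil_append, List.append_assoc, List.singleton_append] at h1 h2
  rw [foldl_tableauInsert_cons, rowInsertWord_append, h1]
  simp only
  rw [h2]
  simp only
  rw [foldl_tableauInsert_of_above hc hs hn]

theorem insertionTableau_append (u v : List ℕ) :
    insertionTableau (u ++ v) = v.foldl tableauInsert (insertionTableau u) := by
  simp [insertionTableau]

/-- The row lengths of the insertion tableau of a word. -/
def rowLengths (w : List ℕ) : List ℕ := (insertionTableau w).map List.length

theorem ne_nil_of_mem_tableauInsert {T : List (List ℕ)} (hT : ∀ r ∈ T, r ≠ []) (x : ℕ) :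
    ∀ r ∈ tableauInsert T x, r ≠ [] := by
  have hne : ∀ x r, (rowInsert x r).1 ≠ [] := by
    intro x r
    cases r with
    | nil => simp [rowInsert]
    | cons y r => by_cases h : x < y <;> simp [rowInsert, h]
  induction T generalizing x with
  | nil => simp [tableauInsert]
  | cons r T ih =>
    have h1 := hne x r
    have hT' : ∀ r ∈ T, r ≠ [] := fun s hs => hT s (by simp [hs])
    rcases h : rowInsert x r with ⟨r', _ | y⟩ <;> rw [h] at h1 <;>
      simp only [tableauInsert, h, List.mem_cons, forall_eq_or_imp]
    · exact ⟨h1, hT'⟩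
    · exact ⟨h1, ih hT' y⟩

theorem pos_of_mem_rowLengths {w : List ℕ} : ∀ n ∈ rowLengths w, 1 ≤ n := by
  have key : ∀ (w : List ℕ) (T : List (List ℕ)), (∀ r ∈ T, r ≠ []) →
      ∀ r ∈ w.foldl tableauInsert T, r ≠ [] := by
    intro w
    induction w with
    | nil => intro T h; exact h
    | cons x w ih => intro T h; exact ih _ (ne_nil_of_mem_tableauInsert h x)
  intro n hn
  obtain ⟨r, hr, rfl⟩ := List.mem_map.1 hn
  exact List.length_pos_iff.2 (key w [] (by simp) r hr)

/-! ### Standardization -/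

theorem rowInsert_map {e : ℕ → ℕ} (he : StrictMono e) (x : ℕ) (r : List ℕ) :
    rowInsert (e x) (r.map e) = ((rowInsert x r).1.map e, (rowInsert x r).2.map e) := by
  induction r with
  | nil => rfl
  | cons y r ih => by_cases h : x < y <;> simp [rowInsert, he.lt_iff_lt, h, ih]

theorem tableauInsert_map {e : ℕ → ℕ} (he : StrictMono e) (T : List (List ℕ)) (x : ℕ) :
    tableauInsert (T.map (List.map e)) (e x) = (tableauInsert T x).map (List.map e) := by
  induction T generalizing x with
  | nil => rfl
  | cons r T ih =>
    rcases h : rowInsert x r with ⟨r', _ | y⟩ <;>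
      simp [tableauInsert, rowInsert_map he, h, ih]

theorem rowLengths_map {e : ℕ → ℕ} (he : StrictMono e) (w : List ℕ) :
    rowLengths (w.map e) = rowLengths w := by
  have key : ∀ (w : List ℕ) (T : List (List ℕ)),
      (w.map e).foldl tableauInsert (T.map (List.map e)) =
        (w.foldl tableauInsert T).map (List.map e) := by
    intro w
    induction w with
    | nil => intro T; rfl
    | cons x w ih => intro T; simp [tableauInsert_map he, ih]
  have := key w []
  simp only [List.map_nil] at this
  simp [rowLengths, insertionTableau, this]

theorem nodup_word (π : Permutation) : (word π).Nodup := by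
  rw [word, List.nodup_ofFn]
  exact Fin.val_injective.comp π.2.injective

/-- Every word without repeated letters is order isomorphic to a permutation. -/
theorem exists_word_map_eq {w : List ℕ} (hw : w.Nodup) :
    ∃ (σ : Permutation) (e : ℕ → ℕ), StrictMono e ∧ (word σ).map e = w := by
  classical
  -- adding all large numbers to the letters gives an infinite set, enumerated by a total `e`
  set p : ℕ → Prop := fun v => v ∈ w ∨ w.sum < v with hp
  have hinf : {v | p v}.Infinite :=
    (Set.Ioi_infinite w.sum).mono fun v hv => Or.inr hv
  have hle : ∀ v ∈ w, v ≤ w.sum := fun v hv => List.single_le_sum (by simp) v hv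
  have hlt : ∀ v ∈ w, Nat.count p v < w.length := by
    intro v hv
    rw [Nat.count_eq_card_filter_range, ← List.toFinset_card_of_nodup hw]
    apply Finset.card_lt_card
    refine ⟨fun u hu => ?_, fun h => ?_⟩
    · simp only [Finset.mem_filter, Finset.mem_range, hp] at hu
      have := hle v hv
      rcases hu.2 with h | h
      · simpa using h
      · omega
    · have := h (List.mem_toFinset.2 hv)
      simp at this
  let f : Fin w.length → Fin w.length := fun i =>
    ⟨Nat.count p w[i], hlt _ (List.getElem_mem _)⟩
  have hf : Function.Injective f := by
    intro i j hij
    have h1 : Nat.count p w[i] = Nat.count p w[j] := congrArg Fin.val hij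
    have h2 := Nat.count_injective (p := p) (Or.inl (List.getElem_mem _))
      (Or.inl (List.getElem_mem _)) h1
    exact Fin.ext ((hw.getElem_inj_iff).1 h2)
  refine ⟨⟨w.length, Equiv.ofBijective f (Finite.injective_iff_bijective.1 hf)⟩, Nat.nth p,
    Nat.nth_strictMono hinf, ?_⟩
  apply List.ext_getElem
  · simp [word]
  · intro i h1 h2
    simp only [word, List.getElem_map, List.getElem_ofFn, Equiv.ofBijective_apply]
    exact Nat.nth_count (p := p) (Or.inl (List.getElem_mem h2))

theorem involved_of_sublist {σ π : Permutation} {e : ℕ → ℕ} (he : StrictMono e) {e' : ℕ → ℕ}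
    (he' : StrictMono e') (h : (word σ).map e <+ (word π).map e') : Involved σ π := by
  obtain ⟨f, hf⟩ := List.sublist_iff_exists_fin_orderEmbedding_get_eq.1 h
  have h1 : ((word σ).map e).length = σ.1 := by simp [word]
  have h2 : ((word π).map e').length = π.1 := by simp [word]
  let g : Fin σ.1 ↪o Fin π.1 :=
    ((Fin.castOrderIso h1.symm).toOrderEmbedding.trans f).trans
      (Fin.castOrderIso h2).toOrderEmbedding
  have hg : ∀ i, e (σ.2 i) = e' (π.2 (g i)) := by
    intro i
    have := hf (Fin.cast h1.symm i)
    simp only [word, List.get_eq_getElem, List.getElem_map, List.getElem_ofFn] at this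
    exact this
  refine ⟨g, fun i j => ?_⟩
  rw [Fin.lt_def, Fin.lt_def, ← he.lt_iff_lt, hg, hg, he'.lt_iff_lt]

/-! ### Words of hook shape -/

theorem insertionTableau_of_sortedGT {w : List ℕ} (h : w.SortedGT) :
    insertionTableau w = w.reverse.map fun a => [a] := by
  induction w using List.reverseRecOn with
  | nil => rfl
  | append_singleton w x ih =>
    have h' := List.pairwise_append.1 h.pairwise
    rw [insertionTableau_append, ih h'.1.sortedGT]
    rw [foldl_tableauInsert_of_above]
    · simp
    · have hr : (x :: w.reverse).IsChain (· < ·) := by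
        have := h.reverse.pairwise.isChain
        simpa using this
      have := hr.imp (S := fun a b => Above [a] [b]) (fun a b hab => ⟨hab, by simp [Above]⟩)
      rw [← List.isChain_map (fun a : ℕ => [a]) (R := Above)] at this
      simpa using this
    · intro s hs
      simp only [List.mem_cons, List.mem_map] at hs
      rcases hs with rfl | ⟨a, _, rfl⟩ <;> exact (List.pairwise_singleton _ _).sortedLT
    · intro s hs
      simp only [List.mem_cons, List.mem_map] at hs
      rcases hs with rfl | ⟨a, _, rfl⟩ <;> simp

theorem rowLengths_of_sortedGT_of_sortedLT {u v : List ℕ} {c : ℕ} (hu : (u ++ [c]).SortedGT)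
    (hv : (c :: v).SortedLT) :
    rowLengths (u ++ c :: v) = (v.length + 1) :: List.replicate u.length 1 := by
  have h1 : u ++ c :: v = (u ++ [c]) ++ v := by simp
  have h2 := rowInsertWord_of_above (p := [c]) (r := v) (b := []) hv (by cases v <;> trivial)
  rw [List.append_nil] at h2
  rw [rowLengths, h1, insertionTableau_append, insertionTableau_of_sortedGT hu]
  simp [foldl_tableauInsert_cons, h2, Function.comp_def]

theorem rowInsert_of_mem {x z : ℕ} {r : List ℕ} (hr : r.Pairwise (· ≤ ·)) (hz : z ∈ r)
    (hx : x < z) : ∃ r' y, rowInsert x r = (r', some y) ∧ x < y ∧ y ≤ z ∧ x ∈ r' ∧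
      r'.Pairwise (· ≤ ·) ∧ r'.length = r.length ∧ ∀ a ∈ r', a = x ∨ a ∈ r := by
  induction r with
  | nil => simp at hz
  | cons b r ih =>
    rw [List.pairwise_cons] at hr
    by_cases hb : x < b
    · refine ⟨x :: r, b, by simp [rowInsert, hb], hb, ?_, by simp, ?_, by simp, by simp +contextual⟩
      · rcases List.mem_cons.1 hz with rfl | h
        · exact le_rfl
        · exact hr.1 _ h
      · exact List.pairwise_cons.2 ⟨fun a ha => hb.le.trans (hr.1 a ha), hr.2⟩
    · have hz' : z ∈ r := by
        rcases List.mem_cons.1 hz with rfl | h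
        · exact absurd hx hb
        · exact h
      obtain ⟨r', y, h1, h2, h3, h4, h5, h6, h7⟩ := ih hr.2 hz'
      refine ⟨b :: r', y, by simp [rowInsert, hb, h1], h2, h3, by simp [h4], ?_, by simp [h6], ?_⟩
      · refine List.pairwise_cons.2 ⟨fun a ha => ?_, h5⟩
        rcases h7 a ha with rfl | h
        · omega
        · exact hr.1 a h
      · intro a ha
        rcases List.mem_cons.1 ha with rfl | h
        · simp
        · rcases h7 a h with h | h <;> simp [h]

/-- A decreasing word whose letters lie below a letter `z` of a row does not lengthen the row,
and the bumped letters decrease, too: each one is at most the letter inserted before it. -/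
theorem rowInsertWord_of_sortedGT {z : ℕ} {r w : List ℕ} (hr : r.Pairwise (· ≤ ·)) (hz : z ∈ r)
    (hw : (z :: w).SortedGT) : (rowInsertWord r w).1.length = r.length ∧
      (rowInsertWord r w).2.length = w.length ∧ (rowInsertWord r w).2.SortedGT ∧
      ∀ y ∈ (rowInsertWord r w).2, y ≤ z := by
  induction w generalizing z r with
  | nil => simp [rowInsertWord, List.sortedGT_iff_pairwise]
  | cons x w ih =>
    have hp := List.pairwise_cons.1 hw.pairwise
    obtain ⟨r', y, h1, h2, h3, h4, h5, h6, -⟩ := rowInsert_of_mem hr hz (hp.1 x (by simp))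
    obtain ⟨g1, g2, g3, g4⟩ := ih h5 h4 hp.2.sortedGT
    simp only [rowInsertWord, h1, Option.toList_some, List.singleton_append, List.length_cons]
    refine ⟨g1.trans h6, by rw [g2], ?_, ?_⟩
    · exact (List.pairwise_cons.2 ⟨fun a ha => (g4 a ha).trans_lt h2, g3.pairwise⟩).sortedGT
    · intro a ha
      rcases List.mem_cons.1 ha with rfl | ha
      · exact h3
      · exact (g4 a ha).trans (h2.le.trans h3)

theorem rowLengths_of_sortedLT_of_sortedGT {u v : List ℕ} {c : ℕ} (hu : (u ++ [c]).SortedLT)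
    (hv : (c :: v).SortedGT) :
    rowLengths (u ++ c :: v) = (u.length + 1) :: List.replicate v.length 1 := by
  have h1 : u ++ c :: v = (u ++ [c]) ++ v := by simp
  obtain ⟨g1, g2, g3, -⟩ := rowInsertWord_of_sortedGT (r := u ++ [c]) (z := c)
    (hu.pairwise.imp fun h => h.le) (by simp) hv
  have h2 : insertionTableau (u ++ [c]) = [u ++ [c]] := by
    refine foldl_tableauInsert_of_above (T := []) (by simp) ?_ ?_
    · simpa using hu
    · simp
  have h3 := insertionTableau_of_sortedGT g3
  rw [insertionTableau] at h3
  rw [rowLengths, h1, insertionTableau_append, h2, foldl_tableauInsert_cons, h3]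
  simp only [List.map_cons, g1, List.map_map, Function.comp_def, List.length_append,
    List.length_singleton, List.map_const', List.length_reverse, g2]

/-- A decreasing word followed by an increasing word, or the other way round, has a subword of
any hook shape that its two parts leave room for. -/
theorem exists_sublist_rowLengths_of_gt_lt {u v : List ℕ} (hu : u.SortedGT) (hv : v.SortedLT)
    (huv : (u ++ v).Nodup) {n m : ℕ} (hn : n < v.length) (hm : m < u.length) :
    ∃ s, s <+ u ++ v ∧ rowLengths s = (n + 1) :: List.replicate m 1 := by
  obtain ⟨b, v, rfl⟩ := List.exists_cons_of_length_pos (Nat.zero_lt_of_lt hn)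
  have hvp := List.pairwise_cons.1 hv.pairwise
  have hu1 : u.take (m + 1) = u.take m ++ [u[m]] := by simp
  have hup := List.pairwise_append.1 (hu1 ▸ hu.pairwise.sublist (List.take_sublist (m + 1) u))
  have hne : u[m] ≠ b := by
    intro h
    exact (List.nodup_append.1 huv).2.2 _ (List.getElem_mem hm) b (by simp) h
  simp only [List.length_cons] at hn
  rcases lt_or_gt_of_ne hne with h | h
  · refine ⟨u.take m ++ u[m] :: (b :: v).take n, ?_, ?_⟩
    · have : u.take m ++ u[m] :: (b :: v).take n = u.take (m + 1) ++ (b :: v).take n := by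
        rw [hu1, List.append_assoc, List.singleton_append]
      rw [this]
      exact (List.take_sublist _ _).append (List.take_sublist _ _)
    · rw [rowLengths_of_sortedGT_of_sortedLT]
      · simp [Nat.min_eq_left (show n ≤ v.length + 1 by omega), Nat.min_eq_left hm.le]
      · rw [← hu1]; exact (hu.pairwise.sublist (List.take_sublist (m + 1) u)).sortedGT
      · refine (List.pairwise_cons.2 ⟨fun a ha => ?_, hv.pairwise.sublist
          (List.take_sublist _ _)⟩).sortedLT
        rcases List.mem_cons.1 (List.mem_of_mem_take ha) with rfl | ha
        · exact h
        · exact h.trans (hvp.1 a ha)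
  · refine ⟨u.take m ++ b :: v.take n, ?_, ?_⟩
    · exact (List.take_sublist _ _).append ((List.take_sublist _ _).cons_cons _)
    · rw [rowLengths_of_sortedGT_of_sortedLT]
      · simp [Nat.min_eq_left (show n ≤ v.length by omega), Nat.min_eq_left hm.le]
      · refine (List.pairwise_append.2 ⟨hup.1, by simp, ?_⟩).sortedGT
        intro a ha c hc
        rw [List.mem_singleton] at hc
        subst hc
        exact h.trans (hup.2.2 a ha _ (by simp))
      · exact (hv.pairwise.sublist ((List.take_sublist n v).cons_cons b)).sortedLT

theorem exists_sublist_rowLengths_of_lt_gt {u v : List ℕ} (hu : u.SortedLT) (hv : v.SortedGT)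
    (huv : (u ++ v).Nodup) {n m : ℕ} (hn : n < u.length) (hm : m < v.length) :
    ∃ s, s <+ u ++ v ∧ rowLengths s = (n + 1) :: List.replicate m 1 := by
  obtain ⟨b, v, rfl⟩ := List.exists_cons_of_length_pos (Nat.zero_lt_of_lt hm)
  have hvp := List.pairwise_cons.1 hv.pairwise
  have hu1 : u.take (n + 1) = u.take n ++ [u[n]] := by simp
  have hup := List.pairwise_append.1 (hu1 ▸ hu.pairwise.sublist (List.take_sublist (n + 1) u))
  have hne : u[n] ≠ b := by
    intro h
    exact (List.nodup_append.1 huv).2.2 _ (List.getElem_mem hn) b (by simp) h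
  simp only [List.length_cons] at hm
  rcases lt_or_gt_of_ne hne with h | h
  · refine ⟨u.take n ++ b :: v.take m, ?_, ?_⟩
    · exact (List.take_sublist _ _).append ((List.take_sublist _ _).cons_cons _)
    · rw [rowLengths_of_sortedLT_of_sortedGT]
      · simp [Nat.min_eq_left (show m ≤ v.length by omega), Nat.min_eq_left hn.le]
      · refine (List.pairwise_append.2 ⟨hup.1, by simp, ?_⟩).sortedLT
        intro a ha c hc
        rw [List.mem_singleton] at hc
        subst hc
        exact (hup.2.2 a ha _ (by simp)).trans h
      · exact (hv.pairwise.sublist ((List.take_sublist m v).cons_cons b)).sortedGT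
  · refine ⟨u.take n ++ u[n] :: (b :: v).take m, ?_, ?_⟩
    · have : u.take n ++ u[n] :: (b :: v).take m = u.take (n + 1) ++ (b :: v).take m := by
        rw [hu1, List.append_assoc, List.singleton_append]
      rw [this]
      exact (List.take_sublist _ _).append (List.take_sublist _ _)
    · rw [rowLengths_of_sortedLT_of_sortedGT]
      · simp [Nat.min_eq_left (show m ≤ v.length + 1 by omega), Nat.min_eq_left hn.le]
      · rw [← hu1]; exact (hu.pairwise.sublist (List.take_sublist (n + 1) u)).sortedLT
      · refine (List.pairwise_cons.2 ⟨fun a ha => ?_, hv.pairwise.sublist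
          (List.take_sublist _ _)⟩).sortedGT
        rcases List.mem_cons.1 (List.mem_of_mem_take ha) with rfl | ha
        · exact h
        · exact (hvp.1 a ha).trans h

/-- A word with long increasing and decreasing subwords has a subword of a given hook shape: cut
the word in the middle of the increasing subword; half of the decreasing subword lies on one side
of the cut, and it meets the half of the increasing subword on the other side. -/
theorem exists_sublist_rowLengths_eq_hook {w u v : List ℕ} (hw : w.Nodup) (hu : u <+ w)
    (hv : v <+ w) (hui : u.SortedLT) (hvd : v.SortedGT) {n m : ℕ}
    (hul : 2 * (n + m + 1) ≤ u.length) (hvl : 2 * (n + m + 1) ≤ v.length) :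
    ∃ s, s <+ w ∧ rowLengths s = (n + 1) :: List.replicate m 1 := by
  rw [← List.take_append_drop (n + m + 1) u, List.append_sublist_iff] at hu
  obtain ⟨w₁, w₂, rfl, hu₁, hu₂⟩ := hu
  obtain ⟨v₁, v₂, rfl, hv₁, hv₂⟩ := List.sublist_append_iff.1 hv
  have hvp := List.pairwise_append.1 hvd.pairwise
  rw [List.length_append] at hvl
  rcases le_total (n + m + 1) v₁.length with h | h
  · have hs := hv₁.append hu₂
    obtain ⟨s, hs1, hs2⟩ := exists_sublist_rowLengths_of_gt_lt hvp.1.sortedGT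
      (hui.pairwise.sublist (List.drop_sublist _ _)).sortedLT (hw.sublist hs) (n := n) (m := m)
      (by simp; omega) (by omega)
    exact ⟨s, hs1.trans hs, hs2⟩
  · have hs := hu₁.append hv₂
    obtain ⟨s, hs1, hs2⟩ := exists_sublist_rowLengths_of_lt_gt
      (hui.pairwise.sublist (List.take_sublist _ _)).sortedLT hvp.2.1.sortedGT (hw.sublist hs)
      (n := n) (m := m) (by simp; omega) (by omega)
    exact ⟨s, hs1.trans hs, hs2⟩

/-! ### A tableau filled column by column -/

/-- `n` consecutive entries of row `i`, from column `a` on, of the filling that has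
`N * j + i` in row `i` and column `j`. -/
def rowSegment (N i a n : ℕ) : List ℕ := (List.range' a n).map fun j => N * j + i

/-- `k` rows of length one, the first of which has index `i`, with the entries that the filling
of `rowSegment` has in column `q`. -/
def columnRows (N q : ℕ) : ℕ → ℕ → List (List ℕ)
  | _, 0 => []
  | i, k + 1 => [N * q + i] :: columnRows N q (i + 1) k

/-- The tableau with rows of lengths `ps`, `l`, and `k` times `1`, the first of which has index
`i`. The entries are those of `rowSegment`, except that the last `k` ones are taken from
column `q` and from the rows with indices `t, …, t + k - 1`. -/
def filling (N q l t k : ℕ) : ℕ → List ℕ → List (List ℕ)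
  | i, [] => rowSegment N i 0 l :: columnRows N q t k
  | i, p :: ps => rowSegment N i 0 p :: filling N q l t k (i + 1) ps

theorem length_rowSegment (N i a n : ℕ) : (rowSegment N i a n).length = n := by
  simp [rowSegment]

theorem rowSegment_append (N i a m n : ℕ) :
    rowSegment N i a (m + n) = rowSegment N i a m ++ rowSegment N i (a + m) n := by
  simp [rowSegment, ← List.range'_append_1]

theorem sortedLT_rowSegment {N : ℕ} (hN : 0 < N) (i a n : ℕ) :
    (rowSegment N i a n).SortedLT := by
  refine (List.pairwise_map.2 ?_).sortedLT
  refine (List.pairwise_lt_range' (s := a) (n := n)).imp fun h => ?_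
  have := Nat.mul_lt_mul_of_pos_left h hN
  omega

theorem above_rowSegment {N i i' : ℕ} (hi : i < i') (a : ℕ) {n n' : ℕ} (hn : n' ≤ n) :
    Above (rowSegment N i a n) (rowSegment N i' a n') := by
  induction n' generalizing a n with
  | zero => cases n <;> trivial
  | succ n' ih =>
    obtain ⟨n, rfl⟩ : ∃ k, n = k + 1 := ⟨n - 1, by omega⟩
    exact ⟨Nat.add_lt_add_left hi _, ih (a + 1) (by omega)⟩

theorem rowSegment_ne_nil {N i a n : ℕ} (hn : 0 < n) : rowSegment N i a n ≠ [] := by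
  rw [← List.length_pos_iff, length_rowSegment]; exact hn

theorem isChain_columnRows (N q i k : ℕ) : (columnRows N q i k).IsChain Above := by
  induction k generalizing i with
  | zero => simp [columnRows]
  | succ k ih =>
    cases k with
    | zero => simp [columnRows]
    | succ k => exact List.isChain_cons_cons.2 ⟨⟨by omega, trivial⟩, ih (i + 1)⟩

theorem length_columnRows (N q i k : ℕ) :
    (columnRows N q i k).map List.length = List.replicate k 1 := by
  induction k generalizing i with
  | zero => rfl
  | succ k ih => simp [columnRows, ih, List.replicate_succ]

theorem mem_columnRows {N q i k : ℕ} : ∀ s ∈ columnRows N q i k,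
    ∃ i', i ≤ i' ∧ i' < i + k ∧ s = [N * q + i'] := by
  induction k generalizing i with
  | zero => simp [columnRows]
  | succ k ih =>
    intro s hs
    rcases List.mem_cons.1 hs with rfl | hs
    · exact ⟨i, le_rfl, by omega, rfl⟩
    · obtain ⟨i', h1, h2, h3⟩ := ih s hs
      exact ⟨i', by omega, by omega, h3⟩

theorem map_length_filling (N q l t k i : ℕ) (ps : List ℕ) :
    (filling N q l t k i ps).map List.length = ps ++ l :: List.replicate k 1 := by
  induction ps generalizing i with
  | nil => simp [filling, length_columnRows, length_rowSegment]
  | cons p ps ih => simp [filling, ih, length_rowSegment]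

theorem isChain_filling {N q l t k i : ℕ} {ps : List ℕ} (hl : 0 < l) (hq : 0 < q)
    (hN : i + ps.length < N) (hps : (ps ++ [l]).SortedGE) :
    (filling N q l t k i ps).IsChain Above := by
  induction ps generalizing i with
  | nil =>
    simp only [List.length_nil] at hN
    cases k with
    | zero => simp [filling, columnRows]
    | succ k =>
      obtain ⟨l, rfl⟩ : ∃ m, l = m + 1 := ⟨l - 1, by omega⟩
      refine List.isChain_cons_cons.2 ⟨⟨?_, ?_⟩, isChain_columnRows N q t (k + 1)⟩
      · have := Nat.le_mul_of_pos_right N hq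
        simp only [Nat.mul_zero]
        omega
      · simp [Above]
  | cons p ps ih =>
    simp only [List.length_cons] at hN
    have hp := List.pairwise_cons.1 hps.pairwise
    have := ih (i := i + 1) (by omega) hp.2.sortedGE
    cases ps with
    | nil =>
      simp only [filling] at this ⊢
      exact List.isChain_cons_cons.2 ⟨above_rowSegment (by omega) 0 (hp.1 l (by simp)), this⟩
    | cons p' ps =>
      simp only [filling] at this ⊢
      exact List.isChain_cons_cons.2 ⟨above_rowSegment (by omega) 0 (hp.1 p' (by simp)), this⟩

theorem mem_filling {N q l t k i : ℕ} {ps : List ℕ} (hl : 0 < l) (hN : 0 < N)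
    (hps : ∀ p ∈ ps, l ≤ p) : ∀ s ∈ filling N q l t k i ps, s.SortedLT ∧ s ≠ [] := by
  induction ps generalizing i with
  | nil =>
    intro s hs
    rcases List.mem_cons.1 hs with rfl | hs
    · exact ⟨sortedLT_rowSegment hN _ _ _, rowSegment_ne_nil hl⟩
    · obtain ⟨i', -, -, rfl⟩ := mem_columnRows s hs
      exact ⟨(List.pairwise_singleton _ _).sortedLT, by simp⟩
  | cons p ps ih =>
    intro s hs
    rcases List.mem_cons.1 hs with rfl | hs
    · exact ⟨sortedLT_rowSegment hN _ _ _, rowSegment_ne_nil (hl.trans_le (hps p (by simp)))⟩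
    · exact ih (fun p' hp' => hps p' (by simp [hp'])) s hs

/-- The row reading word of a tableau: its rows from bottom to top. -/
def readingWord : List (List ℕ) → List ℕ
  | [] => []
  | r :: T => readingWord T ++ r

theorem insertionTableau_readingWord {T : List (List ℕ)} (hc : T.IsChain Above)
    (hs : ∀ s ∈ T, s.SortedLT) (hn : ∀ s ∈ T, s ≠ []) :
    insertionTableau (readingWord T) = T := by
  induction T with
  | nil => rfl
  | cons r T ih =>
    rw [readingWord, insertionTableau_append, ih hc.tail (fun s h => hs s (by simp [h]))
      (fun s h => hn s (by simp [h])), foldl_tableauInsert_of_above hc hs hn]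

theorem mod_of_mem_rowSegment {N i a n y : ℕ} (hi : i < N) (hy : y ∈ rowSegment N i a n) :
    y % N = i := by
  obtain ⟨j, -, rfl⟩ := List.mem_map.1 hy
  rw [Nat.mul_add_mod, Nat.mod_eq_of_lt hi]

theorem nodup_readingWord_columnRows {N q i k : ℕ} (hN : i + k ≤ N) :
    (readingWord (columnRows N q i k)).Nodup ∧
      ∀ y ∈ readingWord (columnRows N q i k), i ≤ y % N := by
  induction k generalizing i with
  | zero => simp [columnRows, readingWord]
  | succ k ih =>
    obtain ⟨h1, h2⟩ := ih (i := i + 1) (by omega)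
    have hmod : (N * q + i) % N = i := by rw [Nat.mul_add_mod, Nat.mod_eq_of_lt (by omega)]
    simp only [columnRows, readingWord]
    refine ⟨List.nodup_append.2 ⟨h1, by simp, ?_⟩, ?_⟩
    · rintro a ha b hb rfl
      have := h2 a ha
      rw [List.mem_singleton.1 hb, hmod] at this
      omega
    · intro y hy
      rcases List.mem_append.1 hy with hy | hy
      · have := h2 y hy; omega
      · rw [List.mem_singleton.1 hy, hmod]

/-- The letters of the reading word are distinct, since those of a row are determined by their
order and those of different rows have different residues modulo `N`. -/
theorem nodup_readingWord_filling {N q l t k i : ℕ} {ps : List ℕ}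
    (ht : i + ps.length < t) (hN : t + k ≤ N) :
    (readingWord (filling N q l t k i ps)).Nodup ∧
      ∀ y ∈ readingWord (filling N q l t k i ps), i ≤ y % N := by
  have step : ∀ {w : List ℕ} {i n : ℕ}, i < N → w.Nodup → (∀ y ∈ w, i + 1 ≤ y % N) →
      (w ++ rowSegment N i 0 n).Nodup ∧ ∀ y ∈ w ++ rowSegment N i 0 n, i ≤ y % N := by
    intro w i n hi h1 h2
    refine ⟨List.nodup_append.2 ⟨h1, (sortedLT_rowSegment (by omega) _ _ _).nodup, ?_⟩, ?_⟩
    · rintro a ha b hb rfl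
      have := h2 a ha
      rw [mod_of_mem_rowSegment hi hb] at this
      omega
    · intro y hy
      rcases List.mem_append.1 hy with hy | hy
      · have := h2 y hy; omega
      · rw [mod_of_mem_rowSegment hi hy]
  induction ps generalizing i with
  | nil =>
    simp only [List.length_nil] at ht
    obtain ⟨h1, h2⟩ := nodup_readingWord_columnRows (q := q) hN
    exact step (by omega) h1 fun y hy => le_trans (by omega) (h2 y hy)
  | cons p ps ih =>
    simp only [List.length_cons] at ht
    obtain ⟨h1, h2⟩ := ih (i := i + 1) (by omega)
    exact step (by omega) h1 h2

/-- Row `i` of the filling with the letter `N * q` put between columns `q - 1` and `q`. -/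
theorem sortedLT_rowSegment_insert {N q i n : ℕ} (hi : 0 < i) (hN : i < N) :
    (rowSegment N i 0 q ++ N * q :: rowSegment N i q n).SortedLT := by
  have hlow : ∀ y ∈ rowSegment N i 0 q, y < N * q := by
    intro y hy
    obtain ⟨j, hj, rfl⟩ := List.mem_map.1 hy
    rw [List.mem_range'_1] at hj
    have : N * (j + 1) ≤ N * q := Nat.mul_le_mul_left N (by omega)
    rw [Nat.mul_add] at this
    omega
  have hhigh : ∀ y ∈ rowSegment N i q n, N * q < y := by
    intro y hy
    obtain ⟨j, hj, rfl⟩ := List.mem_map.1 hy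
    rw [List.mem_range'_1] at hj
    have := Nat.mul_le_mul_left N hj.1
    omega
  have hsort := fun a n => (sortedLT_rowSegment (N := N) (by omega) i a n).pairwise
  refine (List.pairwise_append.2 ⟨hsort 0 q, List.pairwise_cons.2 ⟨hhigh, hsort q n⟩, ?_⟩).sortedLT
  intro a ha b hb
  rcases List.mem_cons.1 hb with rfl | hb
  · exact hlow a ha
  · exact (hlow a ha).trans (hhigh b hb)

/-- Reading the letter `N * q` right after the row of length `q + 1` moves the last box of this
row to a new row of length one, and lengthens the top row. -/
theorem exists_insertionTableau_filling {N q t k i : ℕ} {ps : List ℕ} (hq : 0 < q) (hi : 0 < i)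
    (ht : i + ps.length = t) (hN : t < N) (hps : (ps ++ [q + 1]).SortedGE) :
    ∃ w₁ w₂ n T, readingWord (filling N q (q + 1) (t + 1) k i ps) = w₁ ++ w₂ ∧
      (ps ++ [q]).head (by simp) = q + n ∧
      filling N q q t (k + 1) i ps = rowSegment N i 0 (q + n) :: T ∧
      insertionTableau (w₁ ++ N * q :: w₂) =
        (rowSegment N i 0 q ++ N * q :: rowSegment N i q n) :: T := by
  have hle : ∀ {ps : List ℕ}, (ps ++ [q + 1]).SortedGE → ∀ p ∈ ps, q + 1 ≤ p :=
    fun h p hp => (List.pairwise_append.1 h.pairwise).2.2 p hp _ (by simp)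
  induction ps generalizing i with
  | nil =>
    simp only [List.length_nil, Nat.add_zero] at ht
    subst ht
    have hc := isChain_filling (N := N) (q := q) (t := i + 1) (k := k) (i := i) (l := q + 1)
      (ps := []) (by omega) hq (by simpa using hN) hps
    have hm := mem_filling (N := N) (q := q) (t := i + 1) (k := k) (i := i) (l := q + 1)
      (ps := []) (by omega) (by omega) (by simp)
    have hsort := sortedLT_rowSegment_insert (q := q) (n := 0) hi hN
    have hle : ∀ y ∈ rowSegment N i 0 q, y ≤ N * q := fun y hy =>
      ((List.pairwise_append.1 hsort.pairwise).2.2 y hy _ (by simp)).le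
    have h1 : rowSegment N i 0 (q + 1) = rowSegment N i 0 q ++ [N * q + i] := by
      rw [rowSegment_append]
      simp [rowSegment]
    have h2 : rowInsert (N * q) (rowSegment N i 0 (q + 1)) =
        (rowSegment N i 0 q ++ [N * q], some (N * q + i)) := by
      rw [h1, rowInsert_append hle]
      simp [rowInsert, hi]
    have h3 : tableauInsert (columnRows N q (i + 1) k) (N * q + i) =
        columnRows N q i (k + 1) := by
      refine foldl_tableauInsert_of_above (r := [N * q + i]) (isChain_columnRows N q i (k + 1))
        ?_ ?_ <;> intro s hs <;>
        obtain ⟨i', -, -, rfl⟩ := mem_columnRows (k := k + 1) (i := i) s hs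
      · exact (List.pairwise_singleton _ _).sortedLT
      · simp
    refine ⟨_, [], 0, columnRows N q i (k + 1), (List.append_nil _).symm, by simp, rfl, ?_⟩
    rw [insertionTableau_append, insertionTableau_readingWord hc (fun s hs => (hm s hs).1)
      (fun s hs => (hm s hs).2)]
    simp only [filling, List.foldl_cons, List.foldl_nil, tableauInsert, h2, h3]
    rfl
  | cons p ps ih =>
    simp only [List.length_cons] at ht
    have hp := List.pairwise_cons.1 hps.pairwise
    have hps' : (ps ++ [q + 1]).SortedGE := hp.2.sortedGE
    obtain ⟨w₁, w₂, n, T, h1, h2, h3, h4⟩ := ih (i := i + 1) (by omega) (by omega) hps'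
    obtain ⟨n', rfl⟩ : ∃ n', p = q + n' := ⟨p - q, by have := hle hps p (by simp); omega⟩
    have hnn' : n ≤ n' := by
      cases ps with
      | nil => simp at h2; omega
      | cons p' ps =>
        simp at h2
        have := hp.1 p' (by simp)
        omega
    have hsort : (ps ++ [q]).SortedGE := by
      have hp' := List.pairwise_append.1 hps'.pairwise
      refine (List.pairwise_append.2 ⟨hp'.1, by simp, fun a ha b hb => ?_⟩).sortedGE
      have := hle hps' a ha
      rw [List.mem_singleton.1 hb]
      omega
    have hchain := isChain_filling (N := N) (t := t) (k := k + 1) (i := i + 1) hq hq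
      (by omega) hsort
    have hmem := mem_filling (N := N) (q := q) (t := t) (k := k + 1) (i := i + 1) hq (by omega)
      (fun p hp => (Nat.le_succ q).trans (hle hps' p hp))
    rw [h3, rowSegment_append, Nat.zero_add] at hchain hmem
    refine ⟨w₁, w₂ ++ rowSegment N i 0 (q + n'), n', filling N q q t (k + 1) (i + 1) ps,
      ?_, by simp, rfl, ?_⟩
    · simp [filling, readingWord, h1]
    · rw [← List.cons_append, ← List.append_assoc, insertionTableau_append, h4, h3,
        rowSegment_append, rowSegment_append, Nat.zero_add]
      exact foldl_tableauInsert_split (above_rowSegment (by omega) 0 le_rfl)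
        (by simp [length_rowSegment]) (above_rowSegment (by omega) q hnn')
        (sortedLT_rowSegment_insert hi (by omega)) hchain (fun s hs => (hmem s hs).1)
        (fun s hs => (hmem s hs).2)

/-- For a shape with rows `p`, `ps`, `q + 1` and `k` rows of length one, some word of this shape
is a subword of a word of the shape in which the last box of the row of length `q + 1` has been
replaced by a box at the end of the first row and one at the end of the first column. -/
theorem exists_sublist_rowLengths {p q k : ℕ} {ps : List ℕ} (hq : 0 < q)
    (hps : (p :: ps ++ [q + 1]).SortedGE) :
    ∃ w w' : List ℕ, w'.Nodup ∧ w <+ w' ∧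
      rowLengths w = p :: ps ++ (q + 1) :: List.replicate k 1 ∧
      rowLengths w' = (p + 1) :: ps ++ q :: List.replicate (k + 1) 1 := by
  -- rows are numbered from `1`, so that `N * q` differs from all entries modulo `N`
  obtain ⟨t, ht⟩ : ∃ t, 1 + (p :: ps).length = t := ⟨_, rfl⟩
  obtain ⟨N, hN⟩ : ∃ N, t + 1 + k = N := ⟨_, rfl⟩
  obtain ⟨w₁, w₂, n, T, h1, h2, h3, h4⟩ := exists_insertionTableau_filling (N := N) (k := k) hq
    one_pos ht (by omega) hps
  obtain ⟨h5, h6⟩ := nodup_readingWord_filling (N := N) (q := q) (l := q + 1) (t := t + 1)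
    (k := k) (i := 1) (ps := p :: ps) (by omega) (by omega)
  refine ⟨w₁ ++ w₂, w₁ ++ N * q :: w₂, ?_, ?_, ?_, ?_⟩
  · rw [List.nodup_middle, ← h1]
    refine List.nodup_cons.2 ⟨fun h => ?_, h5⟩
    have := h6 _ h
    simp at this
  · exact (List.Sublist.refl _).append (List.sublist_cons_self _ _)
  · rw [← h1, rowLengths, insertionTableau_readingWord, map_length_filling]
    · exact isChain_filling (by omega) hq (by omega) hps
    all_goals
      intro s hs
      have := mem_filling (by omega) (by omega)
        (fun p hp => (List.pairwise_append.1 hps.pairwise).2.2 p hp _ (by simp)) s hs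
    · exact this.1
    · exact this.2
  · have h7 := congrArg (List.map List.length) h3
    rw [map_length_filling] at h7
    simp only [List.cons_append, List.map_cons, List.cons.injEq, length_rowSegment] at h7
    rw [rowLengths, h4]
    simp [length_rowSegment, ← h7.2, h7.1]
    omega

/-! ### Shapes omitted by a Young class -/

theorem shape_eq_of_rowLengths_eq {π σ : Permutation}
    (h : rowLengths (word π) = rowLengths (word σ)) : shape π = shape σ := by
  have key : ∀ (a b : List ℕ) (ha : a.SortedGE) (hb : b.SortedGE), a = b →
      YoungDiagram.ofRowLens a ha = YoungDiagram.ofRowLens b hb := by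
    rintro a _ ha hb rfl; rfl
  exact key _ _ _ _ h

/-- `C` contains no permutation whose shape has the row lengths `L`. -/
def Omits (C : Set Permutation) (L : List ℕ) : Prop :=
  ∀ π : Permutation, rowLengths (word π) = L → π ∉ C

theorem IsYoungClass.omits {C : Set Permutation} (hC : IsYoungClass C) {π : Permutation}
    (hπ : π ∉ C) : Omits C (rowLengths (word π)) := by
  intro σ hσ
  rcases hC.2 (shape π) with h | h
  · exact absurd (h π rfl) hπ
  · exact h σ (shape_eq_of_rowLengths_eq hσ)

theorem IsYoungClass.omits_of_sublist {C : Set Permutation} (hC : IsYoungClass C)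
    {w w' : List ℕ} (hw' : w'.Nodup) (h : w <+ w') (hO : Omits C (rowLengths w)) :
    Omits C (rowLengths w') := by
  obtain ⟨σ, e, he, rfl⟩ := exists_word_map_eq (hw'.sublist h)
  obtain ⟨π, e', he', rfl⟩ := exists_word_map_eq hw'
  rw [rowLengths_map he] at hO
  rw [rowLengths_map he']
  exact hC.omits fun hπ => hO σ rfl (hC.1 σ π (involved_of_sublist he he' h) hπ)

/-- An omitted shape leads to an omitted hook: move the last box outside the first row and the
first column to the ends of these two, until there is none. -/
theorem IsYoungClass.exists_omits_hook_of_omits {C : Set Permutation} (hC : IsYoungClass C)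
    {p k : ℕ} {ps : List ℕ} (hs : (p :: ps).SortedGE) (hp : ∀ a ∈ p :: ps, 1 ≤ a)
    (hO : Omits C (p :: ps ++ List.replicate k 1)) :
    ∃ n m, Omits C ((n + 1) :: List.replicate m 1) := by
  induction h : ps.sum using Nat.strong_induction_on generalizing p k ps with
  | _ s ih =>
  subst h
  rcases List.eq_nil_or_concat ps with rfl | ⟨ps, a, rfl⟩
  · have := hp p (by simp)
    exact ⟨p - 1, k, by rw [Nat.sub_add_cancel this]; exact hO⟩
  rw [List.concat_eq_append] at *
  have ha : 1 ≤ a := hp a (by simp)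
  have hs' : (p :: ps).SortedGE :=
    (hs.pairwise.sublist ((List.sublist_append_left ps [a]).cons_cons p)).sortedGE
  rcases ha.eq_or_lt with rfl | ha
  · refine ih ps.sum (by simp) (k := k + 1) hs' (fun b hb => hp b ?_) ?_ rfl
    · rw [List.mem_cons] at hb ⊢
      exact hb.imp_right fun h => List.mem_append_left _ h
    · simpa [List.replicate_succ] using hO
  · obtain ⟨q, rfl⟩ : ∃ q, a = q + 1 := ⟨a - 1, by omega⟩
    obtain ⟨w, w', h1, h2, h3, h4⟩ := exists_sublist_rowLengths (k := k) (q := q) (by omega) hs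
    have hO' : Omits C (rowLengths w') := by
      refine hC.omits_of_sublist h1 h2 ?_
      rw [h3]
      simpa using hO
    rw [h4] at hO'
    have hsp := List.pairwise_append.1 (List.pairwise_cons.1 hs.pairwise).2
    have hsc := List.pairwise_cons.1 hs.pairwise
    refine ih (ps ++ [q]).sum (by simp) (p := p + 1) (ps := ps ++ [q]) (k := k + 1)
      ?_ ?_ (by simpa using hO') rfl
    · refine (List.pairwise_cons.2 ⟨fun b hb => ?_, List.pairwise_append.2 ⟨hsp.1, by simp, ?_⟩⟩
        ).sortedGE
      · rcases List.mem_append.1 hb with hb | hb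
        · have := hsc.1 b (by simp [hb]); omega
        · have := hsc.1 (q + 1) (by simp)
          rw [List.mem_singleton] at hb
          omega
      · intro b hb c hc
        have := hsp.2.2 b hb (q + 1) (by simp)
        rw [List.mem_singleton] at hc
        omega
    · intro b hb
      simp only [List.mem_cons, List.mem_append, List.not_mem_nil, or_false] at hb
      rcases hb with rfl | hb | rfl
      · omega
      · exact hp b (by simp [hb])
      · omega

theorem IsYoungClass.exists_omits_hook {C : Set Permutation} (hC : IsYoungClass C)
    (hne : C ≠ Set.univ) : ∃ n m, Omits C ((n + 1) :: List.replicate m 1) := by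
  obtain ⟨π, hπ⟩ := (Set.ne_univ_iff_exists_notMem C).1 hne
  have hO := hC.omits hπ
  have hs : (rowLengths (word π)).SortedGE := sortedGE_insertionTableau (word π)
  have hp := pos_of_mem_rowLengths (w := word π)
  cases h : rowLengths (word π) with
  | nil =>
    rw [h] at hO
    exact ⟨0, 0, hC.omits_of_sublist (w := []) (w' := [0]) (by simp) (by simp) hO⟩
  | cons p ps =>
    rw [h] at hO hs hp
    exact hC.exists_omits_hook_of_omits (k := 0) hs hp (by simpa using hO)

/-! ### Monotone subsequences -/

theorem word_comp_sublist {π : Permutation} {k : ℕ} (f : Fin k ↪o Fin π.1) :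
    (List.ofFn fun i => (π.2 (f i) : ℕ)) <+ word π := by
  have h1 : (List.ofFn fun i => (π.2 (f i) : ℕ)).length = k := by simp
  have h2 : (word π).length = π.1 := by simp [word]
  refine List.sublist_iff_exists_fin_orderEmbedding_get_eq.2
    ⟨((Fin.castOrderIso h1).toOrderEmbedding.trans f).trans
      (Fin.castOrderIso h2.symm).toOrderEmbedding, fun i => ?_⟩
  simp only [word, List.get_eq_getElem, List.getElem_ofFn]
  rfl

theorem IsYoungClass.exists_not_hasIncreasing_and_hasDecreasing {C : Set Permutation}
    (hC : IsYoungClass C) (hne : C ≠ Set.univ) :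
    ∃ k, ∀ π ∈ C, ¬ (HasIncreasing π k ∧ HasDecreasing π k) := by
  obtain ⟨n, m, hO⟩ := hC.exists_omits_hook hne
  refine ⟨2 * (n + m + 1), ?_⟩
  rintro π hπ ⟨⟨f, hf⟩, g, hg⟩
  obtain ⟨s, hs, hs'⟩ := exists_sublist_rowLengths_eq_hook (n := n) (m := m) (nodup_word π)
    (word_comp_sublist f) (word_comp_sublist g) (List.sortedLT_ofFn_iff.2 hf)
    (List.sortedGT_ofFn_iff.2 hg) (by rw [List.length_ofFn])
    (by rw [List.length_ofFn])
  rw [← hs'] at hO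
  exact hC.omits_of_sublist (nodup_word π) hs hO π rfl hπ

theorem involved_increasing_iff {π : Permutation} {a : ℕ} :
    Involved (increasing a) π ↔ HasIncreasing π a :=
  exists_congr fun _ => ⟨fun h i j hij => (h i j).1 hij,
    fun h _ _ => (StrictMono.lt_iff_lt h).symm⟩

theorem involved_decreasing_iff {π : Permutation} {d : ℕ} :
    Involved (decreasing d) π ↔ HasDecreasing π d :=
  exists_congr fun _ => ⟨fun h i j hij => (h j i).1 (Fin.rev_lt_rev.2 hij),
    fun h _ _ => Fin.rev_lt_rev.trans (StrictAnti.lt_iff_gt h).symm⟩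

theorem HasIncreasing.mono {π : Permutation} {k l : ℕ} (h : HasIncreasing π l) (hkl : k ≤ l) :
    HasIncreasing π k := by
  obtain ⟨f, hf⟩ := h
  exact ⟨(Fin.castLEOrderEmb hkl).trans f, hf.comp (Fin.castLEOrderEmb hkl).strictMono⟩

theorem HasDecreasing.mono {π : Permutation} {k l : ℕ} (h : HasDecreasing π l) (hkl : k ≤ l) :
    HasDecreasing π k := by
  obtain ⟨f, hf⟩ := h
  exact ⟨(Fin.castLEOrderEmb hkl).trans f,
    hf.comp_strictMono (Fin.castLEOrderEmb hkl).strictMono⟩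

theorem exists_not_and_iff_exists_subset_union (C : Set Permutation) :
    (∃ k, ∀ π ∈ C, ¬ (HasIncreasing π k ∧ HasDecreasing π k)) ↔
      ∃ a d : ℕ, C ⊆ Av {increasing a} ∪ Av {decreasing d} := by
  simp only [Set.subset_def, Set.mem_union, Av, Set.mem_ofPred_eq, Set.mem_singleton_iff,
    forall_eq, involved_increasing_iff, involved_decreasing_iff, ← not_and_or]
  constructor
  · rintro ⟨k, hk⟩
    exact ⟨k, k, hk⟩
  · rintro ⟨a, d, h⟩
    exact ⟨max a d, fun π hπ hπ' =>
      h π hπ ⟨hπ'.1.mono (le_max_left a d), hπ'.2.mono (le_max_right a d)⟩⟩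

/-! ### Double domination by hooks -/

theorem sum_rowLen_le_card (μ : YoungDiagram) (k : ℕ) :
    ∑ i ∈ Finset.range k, μ.rowLen i ≤ μ.card := by
  classical
  simp only [YoungDiagram.rowLen_eq_card]
  rw [← Finset.card_biUnion]
  · exact Finset.card_le_card (Finset.biUnion_subset.2 fun i _ => Finset.filter_subset _ _)
  · intro i _ j _ hij
    refine Finset.disjoint_left.2 fun c hc hc' => hij ?_
    rw [YoungDiagram.mem_row_iff] at hc hc'
    exact hc.2.symm.trans hc'.2

theorem dominates_of_card_le {μ lam : YoungDiagram} (h : lam.card ≤ μ.rowLen 0) :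
    Dominates μ lam := by
  intro k
  cases k with
  | zero => simp
  | succ k =>
    rw [Finset.sum_range_succ' μ.rowLen]
    exact (sum_rowLen_le_card lam _).trans (h.trans (Nat.le_add_left _ _))

theorem exists_isHook {n : ℕ} (hn : 1 ≤ n) (m : ℕ) : ∃ μ : YoungDiagram, IsHook μ n m := by
  have hs : (n :: List.replicate m 1).SortedGE := by
    refine (List.pairwise_cons.2 ⟨fun a ha => ?_, List.pairwise_replicate.2 (by simp)⟩).sortedGE
    rw [List.eq_of_mem_replicate ha]
    exact hn
  refine ⟨YoungDiagram.ofRowLens _ hs, hn, YoungDiagram.rowLens_ofRowLens_eq_self ?_⟩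
  intro a ha
  rcases List.mem_cons.1 ha with rfl | ha
  · exact hn
  · rw [List.eq_of_mem_replicate ha]
    exact one_pos

/-- A hook with a first row and a first column of at least `|λ|` boxes doubly dominates `λ`. -/
theorem exists_hook_doublyDominates (lam : YoungDiagram) :
    ∃ (n m : ℕ) (μ : YoungDiagram), IsHook μ n m ∧ DoublyDominates μ lam := by
  obtain ⟨μ, hμ⟩ := exists_isHook (n := lam.card + 1) (by omega) lam.card
  refine ⟨_, _, μ, hμ, dominates_of_card_le ?_, dominates_of_card_le ?_⟩
  · have h0 : 0 < μ.rowLens.length := by simp [hμ.2]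
    have h1 := YoungDiagram.get_rowLens (h := h0)
    simp only [hμ.2, List.getElem_cons_zero] at h1
    omega
  · have h1 := YoungDiagram.length_rowLens (μ := μ)
    rw [hμ.2] at h1
    rw [YoungDiagram.rowLen_transpose, ← h1]
    simp [YoungDiagram.card, YoungDiagram.transpose]

end YoungClasses

theorem mainTheorem7 :
    -- every partition is doubly dominated by a hook
    (∀ lam : YoungDiagram, ∃ (n m : ℕ) (μ : YoungDiagram),
      YoungClasses.IsHook μ n m ∧ YoungClasses.DoublyDominates μ lam) ∧
    -- no permutation in a proper Young class has both long monotone subsequences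
    (∀ C : Set YoungClasses.Permutation, YoungClasses.IsYoungClass C → C ≠ Set.univ →
      ∃ k : ℕ, ∀ π ∈ C, ¬ (YoungClasses.HasIncreasing π k ∧ YoungClasses.HasDecreasing π k)) ∧
    -- a proper Young class lies in a union of two classes avoiding monotone permutations
    (∀ C : Set YoungClasses.Permutation, YoungClasses.IsYoungClass C → C ≠ Set.univ →
      ∃ a d : ℕ, C ⊆ YoungClasses.Av {YoungClasses.increasing a} ∪
        YoungClasses.Av {YoungClasses.decreasing d}) ∧
    -- for any permutation class, the last two conclusions are equivalent
    (∀ C : Set YoungClasses.Permutation, YoungClasses.IsPermClass C →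
      ((∃ k : ℕ, ∀ π ∈ C,
          ¬ (YoungClasses.HasIncreasing π k ∧ YoungClasses.HasDecreasing π k)) ↔
        ∃ a d : ℕ, C ⊆ YoungClasses.Av {YoungClasses.increasing a} ∪
          YoungClasses.Av {YoungClasses.decreasing d})) := by
  refine ⟨YoungClasses.exists_hook_doublyDominates,
    fun C hC => hC.exists_not_hasIncreasing_and_hasDecreasing, fun C hC hne => ?_,
    fun C _ => YoungClasses.exists_not_and_iff_exists_subset_union C⟩
  exact (YoungClasses.exists_not_and_iff_exists_subset_union C).1
    (hC.exists_not_hasIncreasing_and_hasDecreasing hne)
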